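/- **Setting.** Let $q>2$ be an integer, let $h\in(0,1)$ be such that $2/h$ is not an integer, and put $\ell^*=\lceil 2/h\rceil$. Let $K,L$ be integers with $K,L\ge 3\ell^*$, and let $\Lambda=(V,E)$ be the $K\times L$ grid with vertex set $V=\{0,\dots,K-1\}\times\{0,\dots,L-1\}$, nearest-neighbour edges $E$ and periodic boundary conditions. Let $\mathcal X=\{1,\dots,q\}^V$, and let $\mathbf 1,\dots,\mathbf q\in\mathcal X$ be the configurations that are constantly equal to $1,\dots,q$. The energy of $\sigma\in\mathcal X$ (ferromagnetic $q$-state Potts model with negative external magnetic field) is $$H(\sigma)=-\sum_{\{v,w\}\in E}\mathbb 1_{\{\sigma(v)=\sigma(w)\}}+h\sum_{u\in V}\mathbb 1_{\{\sigma(u)=1\}}.$$ For inverse temperature $\beta$, let $(X^\beta_t)_{t\in\mathbb N}$ be the Metropolis Markov chain on $\mathcal X$ with transition probabilities $$P_\beta(\sigma,\sigma')=Q(\sigma,\sigma')\,e^{-\beta\max\{0,H(\sigma')-H(\sigma)\}}\quad(\sigma\ne\sigma'),\qquad P_\beta(\sigma,\sigma)=1-\sum_{\eta\ne\sigma}P_\beta(\sigma,\eta),$$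 where $Q(\sigma,\sigma')=\frac1{q|V|}$ if $\sigma$ and $\sigma'$ differ at exactly one vertex and $Q(\sigma,\sigma')=0$ if they differ at more than one vertex. For $A\subset\mathcal X$ let $\tau^\sigma_A=\inf\{t>0: X^\beta_t\in A\}$ be the first hitting time of $A$ for the chain started from $X^\beta_0=\sigma$. A function $f(\beta)\ge 0$ is called super-exponentially small if $\lim_{\beta\to\infty}\frac1\beta\log f(\beta)=-\infty$ (with $\log 0=-\infty$). **Theorem (Recurrence property).** For every $\sigma\in\mathcal X$ and every $\epsilon>0$ there is $k>0$ such that, for all sufficiently large $\beta$, $$\mathbb P\big(\tau^\sigma_{\{\mathbf 1,\dots,\mathbf q\}}>e^{\beta(2+\epsilon)}\big)\le e^{-e^{k\beta}},$$ and the bound $e^{-e^{k\beta}}$ is super-exponentially small. Consequently the probability on the left is super-exponentially small. -/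

import Mathlib

open MeasureTheory ProbabilityTheory Filter Topology
open scoped NNReal ENNReal

namespace Potts

/-- The vertex set `{0, …, K-1} × {0, …, L-1}` of the grid. -/
abbrev Vertex (K L : ℕ) : Type := Fin K × Fin L

/-- The set of spin values `{1, …, q}`. -/
abbrev Spin (q : ℕ) : Type := ↥(Finset.Icc 1 q)

/-- The `K × L` grid with periodic boundary conditions: the box product of two cycles. -/
abbrev torus (K L : ℕ) : SimpleGraph (Vertex K L) :=
  (SimpleGraph.cycleGraph K).boxProd (SimpleGraph.cycleGraph L)

instance (K L : ℕ) : DecidableRel (torus K L).Adj := fun _ _ =>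
  decidable_of_iff _ SimpleGraph.boxProd_adj.symm

/-- Spin configurations. -/
abbrev Config (K L q : ℕ) : Type := Vertex K L → Spin q

/-- The configurations `𝟏, …, 𝐪` in which all spins are equal. -/
def monochromatic (K L q : ℕ) : Set (Config K L q) :=
  Set.range fun (s : Spin q) (_ : Vertex K L) => s

noncomputable section

/-- The energy of a configuration in the negative magnetic field `-h`:
minus the number of edges whose endpoints have equal spins, plus `h` times the number of
vertices with spin `1`. For an edge `e` with endpoints `v` and `w`, `e.map σ` is the unordered
pair of the spins of `v` and `w`, and it `IsDiag` when they agree. -/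
def energy {K L q : ℕ} (h : ℝ) (σ : Config K L q) : ℝ :=
  -(∑ e ∈ (torus K L).edgeFinset, if (e.map σ).IsDiag then (1 : ℝ) else 0)
    + h * ∑ u : Vertex K L, if (σ u : ℕ) = 1 then (1 : ℝ) else 0

/-- The connectivity matrix: `1 / (q |V|)` for configurations that differ at exactly one vertex
(`hammingDist` counts the vertices where two configurations differ), and `0` otherwise. -/
def connectivity {K L q : ℕ} (σ σ' : Config K L q) : ℝ :=
  if hammingDist σ σ' = 1 then 1 / ((q : ℝ) * Fintype.card (Vertex K L)) else 0

/-- The rate `Q(σ, σ') exp (-β [H(σ') - H(σ)]⁺)` of a Metropolis jump from `σ` to `σ'`. -/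
def jump {K L q : ℕ} (h : ℝ) (β : ℝ≥0) (σ σ' : Config K L q) : ℝ :=
  connectivity σ σ' * Real.exp (-(β : ℝ) * max 0 (energy h σ' - energy h σ))

/-- The Metropolis transition matrix at inverse temperature `β`. -/
def transition {K L q : ℕ} (h : ℝ) (β : ℝ≥0) (σ σ' : Config K L q) : ℝ :=
  if σ = σ' then 1 - ∑ η ∈ Finset.univ.erase σ, jump h β σ η else jump h β σ σ'

end

theorem jump_nonneg {K L q : ℕ} (h : ℝ) (β : ℝ≥0) (σ σ' : Config K L q) :
    0 ≤ jump h β σ σ' := by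
  unfold jump connectivity
  split_ifs <;> positivity

theorem jump_le_connectivity {K L q : ℕ} (h : ℝ) (β : ℝ≥0) (σ σ' : Config K L q) :
    jump h β σ σ' ≤ connectivity σ σ' := by
  have hQ : 0 ≤ connectivity σ σ' := by
    unfold connectivity
    split_ifs <;> positivity
  refine mul_le_of_le_one_right hQ (Real.exp_le_one_iff.mpr ?_)
  have h0 : 0 ≤ (β : ℝ) * max 0 (energy h σ' - energy h σ) := by positivity
  linarith

theorem card_hammingDist_one_le {K L q : ℕ} (σ : Config K L q) :
    (Finset.univ.filter fun η : Config K L q => hammingDist σ η = 1).card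
      ≤ q * Fintype.card (Vertex K L) := by
  classical
  have hsub : (Finset.univ.filter fun η : Config K L q => hammingDist σ η = 1)
      ⊆ (Finset.univ : Finset (Vertex K L × Spin q)).image
          fun p => Function.update σ p.1 p.2 := by
    intro η hη
    rw [Finset.mem_filter, hammingDist, Finset.card_eq_one] at hη
    obtain ⟨-, v, hv⟩ := hη
    refine Finset.mem_image.mpr ⟨(v, η v), Finset.mem_univ _, ?_⟩
    funext w
    by_cases hw : w = v
    · subst hw; simp
    · have hnot : w ∉ Finset.univ.filter (fun i => σ i ≠ η i) := by
        rw [hv]; simpa using hw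
      have heq : σ w = η w := by simpa using hnot
      simp [Function.update_of_ne hw, heq]
  calc _ ≤ _ := Finset.card_le_card hsub
    _ ≤ _ := Finset.card_image_le
    _ = q * Fintype.card (Vertex K L) := by
      simp [mul_comm]

theorem sum_jump_le_one {K L q : ℕ} (h : ℝ) (β : ℝ≥0) (σ : Config K L q) :
    ∑ η ∈ Finset.univ.erase σ, jump h β σ η ≤ 1 := by
  calc ∑ η ∈ Finset.univ.erase σ, jump h β σ η
      ≤ ∑ η, jump h β σ η :=
        Finset.sum_le_sum_of_subset_of_nonneg (Finset.subset_univ _)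
          fun η _ _ => jump_nonneg h β σ η
    _ ≤ ∑ η, connectivity σ η := Finset.sum_le_sum fun η _ => jump_le_connectivity h β σ η
    _ = ((Finset.univ.filter fun η : Config K L q => hammingDist σ η = 1).card : ℝ)
          / ((q : ℝ) * Fintype.card (Vertex K L)) := by
        simp only [connectivity]
        rw [← Finset.sum_filter, Finset.sum_const, nsmul_eq_mul, mul_one_div]
    _ ≤ 1 := by
        refine div_le_one_of_le₀ ?_ (by positivity)
        exact_mod_cast card_hammingDist_one_le σ

theorem transition_nonneg {K L q : ℕ} (h : ℝ) (β : ℝ≥0) (σ σ' : Config K L q) :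
    0 ≤ transition h β σ σ' := by
  unfold transition
  split_ifs
  · linarith [sum_jump_le_one h β σ]
  · exact jump_nonneg h β σ σ'

theorem sum_transition {K L q : ℕ} (h : ℝ) (β : ℝ≥0) (σ : Config K L q) :
    ∑ σ', transition h β σ σ' = 1 := by
  rw [← Finset.add_sum_erase _ _ (Finset.mem_univ σ)]
  have hrest : ∑ η ∈ Finset.univ.erase σ, transition h β σ η
      = ∑ η ∈ Finset.univ.erase σ, jump h β σ η := by
    refine Finset.sum_congr rfl fun η hη => ?_
    simp [transition, (Finset.ne_of_mem_erase hη).symm]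
  rw [hrest]
  simp [transition]

noncomputable section

/-- The distribution of the next configuration, given that the present one is `σ`. -/
def stepPMF {K L q : ℕ} (h : ℝ) (β : ℝ≥0) (σ : Config K L q) : PMF (Config K L q) :=
  PMF.ofFintype (fun σ' => ENNReal.ofReal (transition h β σ σ')) (by
    rw [← ENNReal.ofReal_sum_of_nonneg fun η _ => transition_nonneg h β σ η,
      sum_transition, ENNReal.ofReal_one])

/-- The transition matrix as a Markov kernel. -/
def stepKernel (K L q : ℕ) (h : ℝ) (β : ℝ≥0) : Kernel (Config K L q) (Config K L q) :=
  Kernel.ofFunOfCountable fun σ => (stepPMF h β σ).toMeasure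

instance (K L q : ℕ) (h : ℝ) (β : ℝ≥0) : IsMarkovKernel (stepKernel K L q h β) :=
  ⟨fun σ => PMF.toMeasure.isProbabilityMeasure (stepPMF h β σ)⟩

/-- The same transition, as a function of the history up to time `n`: only the configuration at
time `n` matters. -/
def historyKernel (K L q : ℕ) (h : ℝ) (β : ℝ≥0) (n : ℕ) :
    Kernel (Finset.Iic n → Config K L q) (Config K L q) :=
  (stepKernel K L q h β).comap (fun x => x ⟨n, Finset.mem_Iic.mpr le_rfl⟩)
    (measurable_pi_apply _)

instance (K L q : ℕ) (h : ℝ) (β : ℝ≥0) (n : ℕ) : IsMarkovKernel (historyKernel K L q h β n) := by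
  unfold historyKernel; infer_instance

/-- The law, on the space of trajectories `ω : ℕ → Config K L q`, of the Metropolis chain
started from `σ` at time `0`. The chain itself is the coordinate process `X t ω = ω t`. -/
def chainLaw {K L q : ℕ} (h : ℝ) (β : ℝ≥0) (σ : Config K L q) :
    Measure (ℕ → Config K L q) :=
  Kernel.trajMeasure (X := fun _ => Config K L q) (Measure.dirac σ) (historyKernel K L q h β)

/-- The first hitting time `inf {t > 0 : X t ∈ A}` of a set, infinite if there is no such `t`. -/
def hittingTime {K L q : ℕ} (A : Set (Config K L q)) (ω : ℕ → Config K L q) : ℕ∞ :=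
  ⨅ (t : ℕ) (_ : 0 < t ∧ ω t ∈ A), (t : ℕ∞)

/-- The tail `P(τ_A^σ > T)` of the hitting time of `A` for the chain started from `σ`. -/
def hittingTail {K L q : ℕ} (h : ℝ) (β : ℝ≥0) (σ : Config K L q) (A : Set (Config K L q))
    (T : ℝ) : ℝ≥0∞ :=
  chainLaw h β σ {ω | ENNReal.ofReal T < (hittingTime A ω : ℝ≥0∞)}

/-- The critical length `⌈2 / h⌉`. -/
def criticalLength (h : ℝ) : ℕ := ⌈2 / h⌉₊

/-- A nonnegative function `f` of `β` is super-exponentially small if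
`(1 / β) log f(β) → -∞` as `β → ∞`, where `log 0 = -∞`. -/
def SuperExpSmall (f : ℝ≥0 → ℝ≥0∞) : Prop :=
  Tendsto (fun β : ℝ≥0 => ((1 / (β : ℝ) : ℝ) : EReal) * ENNReal.log (f β)) atTop (𝓝 ⊥)

end

end Potts

/-! The proof has a combinatorial half and an analytic half.

Combinatorially, every configuration reaches a constant one by spin flips that stay within `2` of
its initial energy. Take a column of least cost, counting its internal disagreements and its field,
and copy it onto its neighbour site by site. Disagreements across columns cannot increase, by the
triangle inequality. Inside the overwritten column, the copied arc has two ends, each costing at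
most `1`. The remaining change is a partial sum of cost differences with nonpositive total, and the
cycle lemma (`exists_arc_sums_nonpos`) gives a starting site from which all these partial sums are
nonpositive. A finished copy does not raise the energy, so the excess `2` never accumulates. Going
round the torus makes all columns equal, and the same procedure in the other direction makes the
configuration constant (`exists_path_constant`).

Analytically, the chain is reversible for the Boltzmann weight. Telescoping a function that vanishes
on the target along these paths gives a Poincaré inequality with constant `C * exp (2β)`
(`exists_poincare`). Hence the probability of avoiding the target decays in mean square like `exp
(-n / (2 * C * exp (2β)))` (`sum_sq_survival_le`). At `n ≈ exp (β(2 + ε))` this exponent is of order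
`exp (εβ)`, and passing from mean square to a pointwise bound costs only a factor exponential in
`β`. -/

namespace Potts

/-! ### Cyclic sequences and the cycle lemma -/

section Cyclic

theorem sum_boole_le_one {ι : Type*} [Fintype ι] (p : ι → Prop) [DecidablePred p]
    (hp : ∀ i j, p i → p j → i = j) : ∑ i, (if p i then (1 : ℝ) else 0) ≤ 1 := by
  rw [Finset.sum_boole]
  have : (Finset.univ.filter p).card ≤ 1 :=
    Finset.card_le_one.mpr fun a ha b hb =>
      hp a b (Finset.mem_filter.mp ha).2 (Finset.mem_filter.mp hb).2
  exact_mod_cast this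

/-- The cycle lemma: a cyclic sequence with nonpositive sum has a starting point from which all
partial sums are nonpositive. -/
theorem exists_arc_sums_nonpos {L : ℕ} [NeZero L] (x : Fin L → ℝ) (hx : ∑ j, x j ≤ 0) :
    ∃ j₀ : Fin L, ∀ k ≤ L, ∑ j, (if (j - j₀).val < k then x j else 0) ≤ 0 := by
  set y : ℕ → ℝ := fun t => x (Fin.ofNat L t) with hy
  have hrot : ∀ m, ∑ t ∈ Finset.range L, y (m + t) = ∑ j, x j := by
    intro m
    rw [Finset.sum_range, ← Equiv.sum_comp (Equiv.addLeft (Fin.ofNat L m)) x]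
    refine Finset.sum_congr rfl fun j _ => ?_
    simp only [hy, Equiv.coe_addLeft]
    congr 1
    ext
    simp [Fin.val_add]
  -- Start where the prefix sum is maximal: sums from there are later prefix sums minus the maximum.
  -- A further full turn adds the nonpositive total, so the maximum over one period is global.
  obtain ⟨m, -, hm⟩ := Finset.exists_max_image (Finset.range L)
    (fun n => ∑ t ∈ Finset.range n, y t) ⟨0, Finset.mem_range.mpr (NeZero.pos L)⟩
  have hmax : ∀ n, ∑ t ∈ Finset.range n, y t ≤ ∑ t ∈ Finset.range m, y t := by
    intro n
    induction n using Nat.strong_induction_on with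
    | _ n ih =>
      by_cases hn : n < L
      · exact hm n (Finset.mem_range.mpr hn)
      · obtain ⟨r, rfl⟩ := Nat.exists_eq_add_of_le' (not_lt.mp hn)
        rw [Finset.sum_range_add, hrot]
        have := ih r (by have := NeZero.pos L; omega)
        linarith
  refine ⟨Fin.ofNat L m, fun k hk => ?_⟩
  have h1 : ∑ j, (if (j - Fin.ofNat L m).val < k then x j else 0)
      = ∑ t ∈ Finset.range k, y (m + t) := by
    rw [← Equiv.sum_comp (Equiv.addLeft (Fin.ofNat L m))]
    calc _ = ∑ j : Fin L, (if j.val < k then y (m + j) else 0) := by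
          refine Finset.sum_congr rfl fun j _ => ?_
          simp only [hy, Equiv.coe_addLeft, add_sub_cancel_left]
          congr 2
          ext
          simp [Fin.val_add]
      _ = ∑ t ∈ Finset.range L, (if t < k then y (m + t) else 0) :=
          (Finset.sum_range fun t => if t < k then y (m + t) else 0).symm
      _ = _ := by
          rw [← Finset.sum_filter]
          congr 1
          ext t
          simp only [Finset.mem_filter, Finset.mem_range]
          omega
  rw [h1]
  have := hmax (m + k)
  rw [Finset.sum_range_add] at this
  linarith

theorem val_add_one_of_ne_zero {L : ℕ} [NeZero L] (d : Fin L) (hd : d + 1 ≠ 0) :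
    (d + 1).val = d.val + 1 := by
  obtain ⟨n, rfl⟩ := Nat.exists_eq_succ_of_ne_zero (NeZero.ne L)
  rw [Fin.val_add_one, if_neg]
  rintro rfl
  simp at hd

theorem ne_add_one {K : ℕ} [NeZero K] (hK : 2 ≤ K) (i : Fin K) : i ≠ i + 1 := by
  obtain ⟨n, rfl⟩ := Nat.exists_eq_add_of_le' hK
  simp

end Cyclic

/-! ### Disagreement cost on cycles and on the torus -/

section Cost

variable {α : Type*} [DecidableEq α]

/-- The indicator of disagreement. -/
def disagree (s t : α) : ℝ := if s = t then 0 else 1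

theorem disagree_self (s : α) : disagree s s = 0 := by simp [disagree]

theorem disagree_nonneg (s t : α) : 0 ≤ disagree s t := by
  unfold disagree; split_ifs <;> norm_num

theorem disagree_le_one (s t : α) : disagree s t ≤ 1 := by
  unfold disagree; split_ifs <;> norm_num

theorem disagree_triangle (r s t : α) : disagree r t ≤ disagree r s + disagree s t := by
  unfold disagree
  grind

variable (g : α → ℝ)

/-- The energy of a cyclic spin chain: the number of unequal neighbours plus the field `g`. -/
def colCost {L : ℕ} [NeZero L] (a : Fin L → α) : ℝ :=
  ∑ j, (disagree (a j) (a (j + 1)) + g (a j))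

/-- The energy on the torus: the number of unequal neighbours plus the field `g`. -/
def gridCost {K L : ℕ} [NeZero K] [NeZero L] (σ : Fin K × Fin L → α) : ℝ :=
  ∑ i, colCost g (fun j => σ (i, j)) + ∑ j, ∑ i, disagree (σ (i, j)) (σ (i + 1, j))

/-- Only the bonds entering and leaving the arc join a value of `a` to a value of `b`, and each
contributes at most `1`; this is the `2` of the final exponent. Each bond is charged to its first
endpoint, so the other terms match site by site. -/
theorem colCost_arc_le {L : ℕ} [NeZero L] (a b : Fin L → α) (j₀ : Fin L) (k : ℕ) :
    colCost g (fun j => if (j - j₀).val < k then b j else a j) ≤ colCost g a + 2 +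
      ∑ j, (if (j - j₀).val < k then
        (disagree (b j) (b (j + 1)) + g (b j)) - (disagree (a j) (a (j + 1)) + g (a j))
        else 0) := by
  have key : ∀ j, disagree (if (j - j₀).val < k then b j else a j)
        (if (j + 1 - j₀).val < k then b (j + 1) else a (j + 1))
        + g (if (j - j₀).val < k then b j else a j)
      ≤ (disagree (a j) (a (j + 1)) + g (a j)) +
        ((if (j - j₀).val + 1 = k then (1 : ℝ) else 0) + (if j + 1 - j₀ = 0 then (1 : ℝ) else 0)) +
        (if (j - j₀).val < k then
        (disagree (b j) (b (j + 1)) + g (b j)) - (disagree (a j) (a (j + 1)) + g (a j))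
        else 0) := by
    intro j
    have e1 : j + 1 - j₀ = (j - j₀) + 1 := add_sub_right_comm j 1 j₀
    have n1 := disagree_nonneg (a j) (a (j + 1))
    have n2 := disagree_nonneg (b j) (b (j + 1))
    have n3 := disagree_le_one (if (j - j₀).val < k then b j else a j)
        (if (j + 1 - j₀).val < k then b (j + 1) else a (j + 1))
    by_cases hz : j + 1 - j₀ = 0
    · rw [if_pos hz]
      split_ifs at * <;> linarith
    · have hv : (j + 1 - j₀).val = (j - j₀).val + 1 := by
        rw [e1] at hz ⊢
        exact val_add_one_of_ne_zero _ hz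
      rw [if_neg hz]
      rw [hv] at n3 ⊢
      split_ifs at * <;> first | linarith | omega
  calc _ ≤ _ := Finset.sum_le_sum fun j _ => key j
    _ ≤ _ := by
      have s1 : ∑ j : Fin L, (if (j - j₀).val + 1 = k then (1 : ℝ) else 0) ≤ 1 := by
        refine sum_boole_le_one _ fun i j hi hj => ?_
        exact sub_left_injective (Fin.ext (by omega : (i - j₀).val = (j - j₀).val))
      have s2 : ∑ j : Fin L, (if j + 1 - j₀ = 0 then (1 : ℝ) else 0) ≤ 1 := by
        refine sum_boole_le_one _ fun i j hi hj => ?_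
        rw [sub_eq_zero] at hi hj
        exact add_right_cancel (hi.trans hj.symm)
      rw [Finset.sum_add_distrib, Finset.sum_add_distrib,
        Finset.sum_add_distrib (f := fun j : Fin L => if (j - j₀).val + 1 = k then (1 : ℝ) else 0)]
      unfold colCost
      linarith

/-- The bond from `i` to `i + 1` loses its cost `d`, and by the triangle inequality the next bond
gains at most `d`. The proof moves `d` between these two bonds so that the comparison becomes
termwise. -/
theorem sum_disagree_update_le {K : ℕ} [NeZero K] (hK : 2 ≤ K) (ρ : Fin K → α) (i : Fin K) :
    ∑ i', disagree (Function.update ρ (i + 1) (ρ i) i')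
        (Function.update ρ (i + 1) (ρ i) (i' + 1))
      ≤ ∑ i', disagree (ρ i') (ρ (i' + 1)) := by
  set d := disagree (ρ i) (ρ (i + 1)) with hd
  have key : ∀ i', disagree (Function.update ρ (i + 1) (ρ i) i')
        (Function.update ρ (i + 1) (ρ i) (i' + 1)) + (if i' = i then d else 0)
      ≤ disagree (ρ i') (ρ (i' + 1)) + (if i' = i + 1 then d else 0) := by
    intro i'
    by_cases h1 : i' = i
    · subst h1
      simp [ne_add_one hK, disagree_self, hd]
    · by_cases h2 : i' = i + 1
      · subst h2
        rw [if_neg h1, if_pos rfl, Function.update_self,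
          Function.update_of_ne (ne_add_one hK (i + 1)).symm]
        have := disagree_triangle (ρ i) (ρ (i + 1)) (ρ (i + 1 + 1))
        linarith
      · rw [if_neg h1, if_neg h2, Function.update_of_ne h2, Function.update_of_ne]
        simpa using h1
  have := Finset.sum_le_sum fun i' (_ : i' ∈ Finset.univ) => key i'
  simp only [Finset.sum_add_distrib, Finset.sum_ite_eq', Finset.mem_univ, if_true] at this
  linarith

/-- Column `i + 1` is replaced by column `i` along the arc of `k` sites starting at `j₀`. -/
def copyArc {K L : ℕ} [NeZero K] (i : Fin K) (j₀ : Fin L) (k : ℕ) (σ : Fin K × Fin L → α) :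
    Fin K × Fin L → α :=
  fun p => if p.1 = i + 1 ∧ (p.2 - j₀).val < k then σ (i, p.2) else σ p

/-- Bonds between columns are handled one `j` at a time by `sum_disagree_update_le`, which leaves
only the internal cost of the overwritten column. -/
theorem gridCost_copyArc_le {K L : ℕ} [NeZero K] [NeZero L] (hK : 2 ≤ K) (i : Fin K)
    (j₀ : Fin L) (k : ℕ) (σ : Fin K × Fin L → α) :
    gridCost g (copyArc i j₀ k σ) ≤ gridCost g σ +
      (colCost g (fun j => if (j - j₀).val < k then σ (i, j) else σ (i + 1, j))
        - colCost g (fun j => σ (i + 1, j))) := by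
  have hor : ∑ j, ∑ i', disagree (copyArc i j₀ k σ (i', j)) (copyArc i j₀ k σ (i' + 1, j))
      ≤ ∑ j, ∑ i', disagree (σ (i', j)) (σ (i' + 1, j)) := by
    refine Finset.sum_le_sum fun j _ => ?_
    by_cases hj : (j - j₀).val < k
    · have e : ∀ i', copyArc i j₀ k σ (i', j)
          = Function.update (fun i' => σ (i', j)) (i + 1) (σ (i, j)) i' := by
        intro i'
        simp [copyArc, hj, Function.update_apply]
      simp only [e]
      exact sum_disagree_update_le hK (fun i' => σ (i', j)) i
    · simp [copyArc, hj]
  have ver : ∑ i', colCost g (fun j => copyArc i j₀ k σ (i', j))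
      = ∑ i', colCost g (fun j => σ (i', j)) +
      (colCost g (fun j => if (j - j₀).val < k then σ (i, j) else σ (i + 1, j))
        - colCost g (fun j => σ (i + 1, j))) := by
    rw [← Finset.add_sum_erase _ _ (Finset.mem_univ (i + 1)),
      ← Finset.add_sum_erase _ (fun i' => colCost g (fun j => σ (i', j)))
        (Finset.mem_univ (i + 1))]
    have : ∑ i' ∈ Finset.univ.erase (i + 1), colCost g (fun j => copyArc i j₀ k σ (i', j))
        = ∑ i' ∈ Finset.univ.erase (i + 1), colCost g (fun j => σ (i', j)) := by
      refine Finset.sum_congr rfl fun i' hi' => ?_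
      simp [copyArc, Finset.ne_of_mem_erase hi']
    rw [this]
    simp only [copyArc, true_and]
    ring
  unfold gridCost
  linarith

theorem gridCost_swap {K L : ℕ} [NeZero K] [NeZero L] (σ : Fin K × Fin L → α) :
    gridCost g (fun p : Fin L × Fin K => σ p.swap) = gridCost g σ := by
  simp only [gridCost, colCost, Finset.sum_add_distrib, Prod.swap_prod_mk]
  rw [Finset.sum_comm (f := fun (i : Fin L) (j : Fin K) => g (σ (j, i)))]
  ring

end Cost

/-! ### Low-energy paths to constant configurations -/

section Paths

/-- A single spin flip between configurations of energy at most `M`. -/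
def LowFlip {V α : Type*} [Fintype V] [DecidableEq α] (E : (V → α) → ℝ) (M : ℝ)
    (σ τ : V → α) : Prop :=
  hammingDist σ τ = 1 ∧ E σ ≤ M ∧ E τ ≤ M

theorem LowFlip.mono {V α : Type*} [Fintype V] [DecidableEq α] {E : (V → α) → ℝ} {M M' : ℝ}
    (hM : M ≤ M') {σ τ : V → α} (h : LowFlip E M σ τ) : LowFlip E M' σ τ :=
  ⟨h.1, h.2.1.trans hM, h.2.2.trans hM⟩

theorem reflTransGen_lowFlip {V α : Type*} [Fintype V] [DecidableEq α] {E : (V → α) → ℝ} {M : ℝ}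
    {σ τ : V → α} (hd : hammingDist σ τ ≤ 1) (hσ : E σ ≤ M) (hτ : E τ ≤ M) :
    Relation.ReflTransGen (LowFlip E M) σ τ := by
  rcases Nat.le_one_iff_eq_zero_or_eq_one.mp hd with h | h
  · rw [hammingDist_eq_zero.mp h]
  · exact .single ⟨h, hσ, hτ⟩

theorem hammingDist_swap {K L : ℕ} {α : Type*} [DecidableEq α] (σ τ : Fin L × Fin K → α) :
    hammingDist (fun p : Fin K × Fin L => σ p.swap) (fun p => τ p.swap) = hammingDist σ τ := by
  unfold hammingDist
  refine Finset.card_equiv (Equiv.prodComm _ _) fun p => ?_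
  simp

variable {α : Type*} [DecidableEq α] (g : α → ℝ) {K L : ℕ} [NeZero K] [NeZero L]

/-- A column can be copied onto the next one, if that does not increase the cost of the column,
without climbing by more than `2`. -/
theorem exists_path_copy_column (hK : 2 ≤ K) (i : Fin K) (σ : Fin K × Fin L → α)
    (hc : colCost g (fun j => σ (i, j)) ≤ colCost g (fun j => σ (i + 1, j))) :
    gridCost g (fun p => if p.1 = i + 1 then σ (i, p.2) else σ p) ≤ gridCost g σ ∧
    Relation.ReflTransGen (LowFlip (gridCost g) (gridCost g σ + 2)) σ
      (fun p => if p.1 = i + 1 then σ (i, p.2) else σ p) := by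
  -- The cycle lemma is applied to the sitewise cost differences; `hc` says exactly that their total
  -- is nonpositive.
  obtain ⟨j₀, hj₀⟩ := exists_arc_sums_nonpos
    (fun j => (disagree (σ (i, j)) (σ (i, j + 1)) + g (σ (i, j)))
      - (disagree (σ (i + 1, j)) (σ (i + 1, j + 1)) + g (σ (i + 1, j))))
    (by rw [Finset.sum_sub_distrib]; unfold colCost at hc; linarith)
  have full : copyArc i j₀ L σ = fun p => if p.1 = i + 1 then σ (i, p.2) else σ p := by
    funext p
    simp [copyArc]
  have bound : ∀ k ≤ L, gridCost g (copyArc i j₀ k σ) ≤ gridCost g σ + 2 := by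
    intro k hk
    have h1 := gridCost_copyArc_le g hK i j₀ k σ
    have h2 := colCost_arc_le g (fun j => σ (i + 1, j)) (fun j => σ (i, j)) j₀ k
    have h3 := hj₀ k hk
    linarith
  have path : ∀ k ≤ L, Relation.ReflTransGen (LowFlip (gridCost g) (gridCost g σ + 2)) σ
      (copyArc i j₀ k σ) := by
    intro k
    induction k with
    | zero =>
      intro _
      have : copyArc i j₀ 0 σ = σ := by funext p; simp [copyArc]
      rw [this]
    | succ k ih =>
      intro hk
      refine (ih (by omega)).trans (reflTransGen_lowFlip ?_ (bound k (by omega)) (bound _ hk))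
      refine Finset.card_le_one.mpr ?_
      have aux : ∀ p, copyArc i j₀ k σ p ≠ copyArc i j₀ (k + 1) σ p →
          p.1 = i + 1 ∧ (p.2 - j₀).val = k := by
        intro p hp
        by_contra hcon
        refine hp ?_
        unfold copyArc
        congr 1
        simp only [eq_iff_iff, and_congr_right_iff]
        intro hp1
        have : (p.2 - j₀).val ≠ k := fun h => hcon ⟨hp1, h⟩
        omega
      intro p hp p' hp'
      obtain ⟨h1, h2⟩ := aux p (Finset.mem_filter.mp hp).2
      obtain ⟨h1', h2'⟩ := aux p' (Finset.mem_filter.mp hp').2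
      exact Prod.ext (h1.trans h1'.symm) (sub_left_injective (Fin.ext (h2.trans h2'.symm)))
  rw [← full]
  refine ⟨?_, path L le_rfl⟩
  have h1 := gridCost_copyArc_le g hK i j₀ L σ
  simp only [Fin.is_lt, if_true] at h1
  linarith

/-- Every configuration can be made constant in the first direction, without climbing by more than
`2` and without ending higher. -/
theorem exists_path_constant_columns (hK : 2 ≤ K) (σ : Fin K × Fin L → α) :
    ∃ c : Fin K, gridCost g (fun p : Fin K × Fin L => σ (c, p.2)) ≤ gridCost g σ ∧
      Relation.ReflTransGen (LowFlip (gridCost g) (gridCost g σ + 2)) σ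
        (fun p => σ (c, p.2)) := by
  -- With `c` a cheapest column, its copy is never dearer than the column it replaces, so every
  -- copying step is admissible.
  obtain ⟨c, -, hc⟩ := Finset.exists_min_image Finset.univ
    (fun i => colCost g (fun j => σ (i, j))) ⟨0, Finset.mem_univ (0 : Fin K)⟩
  refine ⟨c, ?_⟩
  suffices H : ∀ m < K,
      gridCost g (fun p => if (p.1 - c).val ≤ m then σ (c, p.2) else σ p) ≤ gridCost g σ ∧
      Relation.ReflTransGen (LowFlip (gridCost g) (gridCost g σ + 2)) σ
        (fun p => if (p.1 - c).val ≤ m then σ (c, p.2) else σ p) by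
    have hpos := NeZero.pos K
    have := H (K - 1) (by omega)
    have e : ∀ i : Fin K, i.val ≤ K - 1 := fun i => by omega
    simpa only [e, if_true] using this
  intro m
  induction m with
  | zero =>
    intro _
    have : (fun p : Fin K × Fin L => if (p.1 - c).val ≤ 0 then σ (c, p.2) else σ p) = σ := by
      funext p
      simp only [nonpos_iff_eq_zero, Fin.val_eq_zero_iff, sub_eq_zero]
      split_ifs with h
      · rw [← h]
      · rfl
    rw [this]
    exact ⟨le_rfl, .refl⟩
  | succ m ih =>
    intro hm
    obtain ⟨hE, hR⟩ := ih (by omega)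
    set τ : Fin K × Fin L → α := fun p => if (p.1 - c).val ≤ m then σ (c, p.2) else σ p with hτ
    have hmc : (Fin.ofNat K m).val = m := Nat.mod_eq_of_lt (by omega)
    have hmc1 : (Fin.ofNat K m + 1).val = m + 1 := by
      rw [val_add_one_of_ne_zero, hmc]
      intro h0
      have : (Fin.ofNat K m + 1).val = (m + 1) % K := by simp [Fin.val_add]
      rw [h0, Nat.mod_eq_of_lt hm] at this
      simp at this
    set i : Fin K := c + Fin.ofNat K m with hi
    have hi0 : (i - c).val = m := by rw [hi, add_sub_cancel_left, hmc]
    have hi1 : (i + 1 - c).val = m + 1 := by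
      rw [hi, show c + Fin.ofNat K m + 1 - c = Fin.ofNat K m + 1 by abel, hmc1]
    have hcol : ∀ j, τ (i, j) = σ (c, j) := fun j => by simp [hτ, hi0]
    have hcol1 : ∀ j, τ (i + 1, j) = σ (i + 1, j) := fun j => by simp [hτ, hi1]
    have step := exists_path_copy_column g hK i τ (by
      simp only [hcol, hcol1]
      exact hc (i + 1) (Finset.mem_univ _))
    have e : (fun p => if p.1 = i + 1 then τ (i, p.2) else τ p)
        = fun p : Fin K × Fin L => if (p.1 - c).val ≤ m + 1 then σ (c, p.2) else σ p := by
      funext p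
      by_cases hp : p.1 = i + 1
      · simp [hp, hcol, hi1]
      · have : (p.1 - c).val ≠ m + 1 := by
          rw [← hi1]
          exact fun h => hp (sub_left_injective (Fin.ext h))
        have : (p.1 - c).val ≤ m + 1 ↔ (p.1 - c).val ≤ m := by omega
        simp [hp, hτ, this]
    rw [e] at step
    refine ⟨step.1.trans hE, hR.trans ?_⟩
    exact Relation.ReflTransGen.mono (fun _ _ => LowFlip.mono (by linarith)) _ _ step.2

/-- Every configuration is connected to a constant one by spin flips that climb by at most `2`. -/
theorem exists_path_constant (hK : 2 ≤ K) (hL : 2 ≤ L) (σ : Fin K × Fin L → α) :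
    ∃ s : α, Relation.ReflTransGen (LowFlip (gridCost g) (gridCost g σ + 2)) σ
      (fun _ => s) := by
  obtain ⟨c, hE, hR⟩ := exists_path_constant_columns g hK σ
  -- The second pass acts on the transposed configuration. It starts no higher than `σ`, so the same
  -- ceiling serves both passes.
  obtain ⟨d, -, hR'⟩ := exists_path_constant_columns g hL
    (fun p : Fin L × Fin K => σ (c, p.swap.2))
  refine ⟨σ (c, d), hR.trans ?_⟩
  have hE' : gridCost g (fun p : Fin L × Fin K => σ (c, p.swap.2))
      = gridCost g (fun p : Fin K × Fin L => σ (c, p.2)) :=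
    gridCost_swap g (fun p : Fin K × Fin L => σ (c, p.2))
  refine Relation.ReflTransGen.lift (p := LowFlip (gridCost g) (gridCost g σ + 2))
    (fun (η : Fin L × Fin K → α) (p : Fin K × Fin L) => η p.swap) (fun a b hab => ?_) _ _ hR'
  refine ⟨(hammingDist_swap a b).trans hab.1, ?_, ?_⟩
  · rw [gridCost_swap g a]; linarith [hab.2.1]
  · rw [gridCost_swap g b]; linarith [hab.2.2]

end Paths

/-! ### From the Potts energy to the grid cost -/

section Energy

/-- Side lengths at least `3` make the map from a site to its forward edge injective; on a cycle of
length `2` both sites would give the same edge. -/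
theorem sum_torus_edgeFinset {K L : ℕ} [NeZero K] [NeZero L] (hK : 3 ≤ K) (hL : 3 ≤ L)
    (F : Sym2 (Vertex K L) → ℝ) :
    ∑ e ∈ (torus K L).edgeFinset, F e = ∑ i, ∑ j, F s((i, j), (i, j + 1))
      + ∑ j, ∑ i, F s((i, j), (i + 1, j)) := by
  obtain ⟨m, rfl⟩ := Nat.exists_eq_add_of_le' (show 2 ≤ K by omega)
  obtain ⟨n, rfl⟩ := Nat.exists_eq_add_of_le' (show 2 ≤ L by omega)
  have two_ne : ∀ r : ℕ, 3 ≤ r + 2 → (1 + 1 : Fin (r + 2)) ≠ 0 := by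
    intro r hr h
    have := congrArg Fin.val h
    rw [Fin.val_add, Fin.val_one, Fin.val_zero, Nat.mod_eq_of_lt (by omega)] at this
    omega
  have no_two : ∀ r : ℕ, 3 ≤ r + 2 → ∀ x : Fin (r + 2), x + 1 + 1 ≠ x := by
    intro r hr x h
    rw [add_assoc] at h
    exact two_ne r hr (by simpa using h)
  set f₁ : Vertex (m + 2) (n + 2) → Sym2 (Vertex (m + 2) (n + 2)) :=
    fun p => s(p, (p.1, p.2 + 1)) with hf₁
  set f₂ : Vertex (m + 2) (n + 2) → Sym2 (Vertex (m + 2) (n + 2)) :=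
    fun p => s(p, (p.1 + 1, p.2)) with hf₂
  have inj₁ : Function.Injective f₁ := by
    rintro ⟨a, b⟩ ⟨c, d⟩ h
    simp only [hf₁, Sym2.eq_iff, Prod.mk.injEq] at h
    rcases h with ⟨h, -⟩ | ⟨⟨-, h1⟩, -, h2⟩
    · exact Prod.ext h.1 h.2
    · exact absurd (by rw [← h1, h2]) (no_two n hL d)
  have inj₂ : Function.Injective f₂ := by
    rintro ⟨a, b⟩ ⟨c, d⟩ h
    simp only [hf₂, Sym2.eq_iff, Prod.mk.injEq] at h
    rcases h with ⟨h, -⟩ | ⟨⟨h1, -⟩, h2, -⟩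
    · exact Prod.ext h.1 h.2
    · exact absurd (by rw [← h1, h2]) (no_two m hK c)
  have hset : (torus (m + 2) (n + 2)).edgeFinset
      = Finset.univ.image f₁ ∪ Finset.univ.image f₂ := by
    ext e
    induction e using Sym2.ind with
    | _ x y =>
      obtain ⟨a, b⟩ := x
      obtain ⟨c, d⟩ := y
      simp only [SimpleGraph.mem_edgeFinset, SimpleGraph.mem_edgeSet, SimpleGraph.boxProd_adj,
        SimpleGraph.cycleGraph_adj, Finset.mem_union, Finset.mem_image, Finset.mem_univ, true_and,
        hf₁, hf₂, Sym2.eq_iff, Prod.exists, Prod.mk.injEq]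
      constructor
      · rintro (⟨h | h, rfl⟩ | ⟨h | h, rfl⟩)
        · exact .inr ⟨c, b, .inr ⟨⟨rfl, rfl⟩, by rw [← h]; abel, rfl⟩⟩
        · exact .inr ⟨a, b, .inl ⟨⟨rfl, rfl⟩, by rw [← h]; abel, rfl⟩⟩
        · exact .inl ⟨a, d, .inr ⟨⟨rfl, rfl⟩, rfl, by rw [← h]; abel⟩⟩
        · exact .inl ⟨a, b, .inl ⟨⟨rfl, rfl⟩, rfl, by rw [← h]; abel⟩⟩
      · rintro (⟨x, y, ⟨⟨rfl, rfl⟩, rfl, rfl⟩ | ⟨⟨rfl, rfl⟩, rfl, rfl⟩⟩ |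
          ⟨x, y, ⟨⟨rfl, rfl⟩, rfl, rfl⟩ | ⟨⟨rfl, rfl⟩, rfl, rfl⟩⟩) <;> simp
  have hdisj : Disjoint (Finset.univ.image f₁) (Finset.univ.image f₂) := by
    rw [Finset.disjoint_left]
    intro e he he'
    obtain ⟨⟨a, b⟩, -, rfl⟩ := Finset.mem_image.mp he
    obtain ⟨⟨c, d⟩, -, h⟩ := Finset.mem_image.mp he'
    simp only [hf₁, hf₂, Sym2.eq_iff, Prod.mk.injEq] at h
    rcases h with ⟨⟨h1, -⟩, h2, -⟩ | ⟨⟨h1, -⟩, h2, -⟩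
    · exact (ne_add_one (by omega) c) (h1.trans h2.symm)
    · exact (ne_add_one (by omega) c) (h1.trans h2.symm)
  rw [hset, Finset.sum_union hdisj, Finset.sum_image fun _ _ _ _ h => inj₁ h,
    Finset.sum_image fun _ _ _ _ h => inj₂ h, Fintype.sum_prod_type, Fintype.sum_prod_type_right]

/-- The external field acting on a spin. -/
noncomputable def field {q : ℕ} (h : ℝ) (s : Spin q) : ℝ := if (s : ℕ) = 1 then h else 0

theorem energy_eq_gridCost {K L q : ℕ} [NeZero K] [NeZero L] (hK : 3 ≤ K) (hL : 3 ≤ L) (h : ℝ)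
    (σ : Config K L q) :
    energy h σ = gridCost (field h) σ - (torus K L).edgeFinset.card := by
  have e1 : -(∑ e ∈ (torus K L).edgeFinset, if (e.map σ).IsDiag then (1 : ℝ) else 0)
      = ∑ e ∈ (torus K L).edgeFinset, (if (e.map σ).IsDiag then (0 : ℝ) else 1)
        - (torus K L).edgeFinset.card := by
    rw [Finset.card_eq_sum_ones, Nat.cast_sum, ← Finset.sum_neg_distrib, ← Finset.sum_sub_distrib]
    refine Finset.sum_congr rfl fun e _ => ?_
    split_ifs <;> norm_num
  have e2 : h * ∑ u : Vertex K L, (if (σ u : ℕ) = 1 then (1 : ℝ) else 0)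
      = ∑ i, ∑ j, field h (σ (i, j)) := by
    rw [Finset.mul_sum, Fintype.sum_prod_type]
    simp [field]
  unfold energy
  rw [e1, e2, sum_torus_edgeFinset hK hL]
  simp only [Sym2.map_mk, Sym2.mk_isDiag_iff, gridCost, colCost, Finset.sum_add_distrib,
    disagree]
  ring

/-- The stability level of every configuration outside `{𝟏, …, 𝐪}` is at most `2`. -/
theorem exists_path_monochromatic {K L q : ℕ} (hK : 3 ≤ K) (hL : 3 ≤ L) (h : ℝ)
    (σ : Config K L q) :
    ∃ τ ∈ monochromatic K L q,
      Relation.ReflTransGen (LowFlip (energy h) (energy h σ + 2)) σ τ := by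
  have : NeZero K := ⟨by omega⟩
  have : NeZero L := ⟨by omega⟩
  obtain ⟨s, hs⟩ := exists_path_constant (field h) (by omega) (by omega) σ
  refine ⟨_, ⟨s, rfl⟩, Relation.ReflTransGen.mono (fun a b hab => ⟨hab.1, ?_, ?_⟩) _ _ hs⟩
  · rw [energy_eq_gridCost hK hL, energy_eq_gridCost hK hL]; linarith [hab.2.1]
  · rw [energy_eq_gridCost hK hL, energy_eq_gridCost hK hL]; linarith [hab.2.2]

end Energy

end Potts

/-! ### Survival probabilities of reversible chains -/

namespace Potts

/-- Telescoping along the path. Choosing `n` before `f` and `D` is what later makes the Poincaré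
prefactor independent of `β`. -/
theorem exists_path_length {S : Type*} {R : S → S → Prop} {x a : S} (hxa : Relation.ReflTransGen R x a) :
    ∃ n : ℕ, ∀ (f : S → ℝ) (D : ℝ), (∀ y z, R y z → |f y - f z| ≤ D) →
      |f x - f a| ≤ n * D := by
  induction hxa with
  | refl => exact ⟨0, by simp⟩
  | @tail b c _ hbc ih =>
    obtain ⟨n, hn⟩ := ih
    refine ⟨n + 1, fun f D hD => ?_⟩
    have h1 := hn f D hD
    have h2 := hD _ _ hbc
    push_cast
    refine (abs_sub_le _ (f b) _).trans ?_
    linarith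

section ReversibleChain

variable {S : Type*} [Fintype S] (P : S → S → ℝ) (A : Set S)

/-- The probability that a chain with transition matrix `P` avoids `A` at times `1, …, n`. -/
noncomputable def survival : ℕ → S → ℝ
  | 0, _ => 1
  | n + 1, x => ∑ y, P x y * Aᶜ.indicator (survival n) y

theorem survival_nonneg (hP : ∀ x y, 0 ≤ P x y) (n : ℕ) (x : S) : 0 ≤ survival P A n x := by
  induction n generalizing x with
  | zero => exact zero_le_one
  | succ n ih =>
    exact Finset.sum_nonneg fun y _ =>
      mul_nonneg (hP x y) (Set.indicator_nonneg (fun y _ => ih y) y)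

theorem survival_succ_le (hP : ∀ x y, 0 ≤ P x y) (hP1 : ∀ x, ∑ y, P x y = 1) (n : ℕ) (x : S) :
    survival P A (n + 1) x ≤ survival P A n x := by
  induction n generalizing x with
  | zero =>
    calc survival P A 1 x ≤ ∑ y, P x y := by
          refine Finset.sum_le_sum fun y _ => mul_le_of_le_one_right (hP x y) ?_
          exact Set.indicator_apply_le' (fun _ => le_rfl) (fun _ => zero_le_one)
      _ = 1 := hP1 x
  | succ n ih =>
    exact Finset.sum_le_sum fun y _ => mul_le_mul_of_nonneg_left
      (Set.indicator_le_indicator (ih y)) (hP x y)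

theorem sum_sq_sub_eq {μ : S → ℝ} (hP1 : ∀ x, ∑ y, P x y = 1)
    (hrev : ∀ x y, μ x * P x y = μ y * P y x) (f : S → ℝ) :
    ∑ x, ∑ y, μ x * P x y * (f x - f y) ^ 2
      = 2 * (∑ x, μ x * f x ^ 2 - ∑ x, μ x * (f x * ∑ y, P x y * f y)) := by
  have h1 : ∑ x, ∑ y, μ x * P x y * f x ^ 2 = ∑ x, μ x * f x ^ 2 := by
    refine Finset.sum_congr rfl fun x _ => ?_
    rw [← Finset.sum_mul, ← Finset.mul_sum, hP1, mul_one]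
  have h2 : ∑ x, ∑ y, μ x * P x y * f y ^ 2 = ∑ x, μ x * f x ^ 2 := by
    rw [Finset.sum_comm, ← h1]
    exact Finset.sum_congr rfl fun x _ => Finset.sum_congr rfl fun y _ => by rw [hrev]
  have h3 : ∑ x, ∑ y, μ x * P x y * (f x * f y) = ∑ x, μ x * (f x * ∑ y, P x y * f y) := by
    refine Finset.sum_congr rfl fun x _ => ?_
    rw [Finset.mul_sum, Finset.mul_sum]
    exact Finset.sum_congr rfl fun y _ => by ring
  have h4 : ∀ x y, μ x * P x y * (f x - f y) ^ 2
      = μ x * P x y * f x ^ 2 + μ x * P x y * f y ^ 2 - 2 * (μ x * P x y * (f x * f y)) := by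
    intro x y; ring
  simp only [h4, Finset.sum_sub_distrib, Finset.sum_add_distrib, ← Finset.mul_sum, h1, h2, h3]
  ring

/-- A Poincaré inequality for functions that vanish on `A` makes the survival probability decay
exponentially in mean square. -/
theorem sum_sq_survival_le {μ : S → ℝ} (hμ : ∀ x, 0 ≤ μ x) (hP : ∀ x y, 0 ≤ P x y)
    (hP1 : ∀ x, ∑ y, P x y = 1) (hrev : ∀ x y, μ x * P x y = μ y * P y x) {D : ℝ} (hD : 0 < D)
    (hpoinc : ∀ f : S → ℝ, (∀ x ∈ A, f x = 0) →
      ∑ x, μ x * f x ^ 2 ≤ D * ∑ x, ∑ y, μ x * P x y * (f x - f y) ^ 2) (n : ℕ) :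
    ∑ x, μ x * Aᶜ.indicator (survival P A n) x ^ 2 ≤ Real.exp (-(n / (2 * D))) * ∑ x, μ x := by
  induction n with
  | zero =>
    simp only [Nat.cast_zero, zero_div, neg_zero, Real.exp_zero, one_mul]
    refine Finset.sum_le_sum fun x _ => mul_le_of_le_one_right (hμ x) ?_
    by_cases hx : x ∈ A <;> simp [hx, survival]
  | succ n ih =>
    set u := Aᶜ.indicator (survival P A n) with hu
    set v := Aᶜ.indicator (survival P A (n + 1)) with hv
    have hv0 : ∀ x, 0 ≤ v x :=
      Set.indicator_nonneg fun x _ => survival_nonneg P A hP (n + 1) x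
    have hvu : ∀ x, v x ≤ u x := fun x =>
      Set.indicator_le_indicator (survival_succ_le P A hP hP1 n x)
    -- Off `A`, `v` is the image of `u` under `P`, and `v ≤ u`; so one factor of `v ^ 2` can be
    -- relaxed to `u`. This yields the Dirichlet form directly, with no lower bound on the spectrum
    -- of `P`.
    have hstep : ∑ x, μ x * v x ^ 2 ≤ ∑ x, μ x * (u x * ∑ y, P x y * u y) := by
      refine Finset.sum_le_sum fun x _ => mul_le_mul_of_nonneg_left ?_ (hμ x)
      by_cases hx : x ∈ A
      · simp [hu, hv, hx]
      · have hvx : v x = ∑ y, P x y * u y := by simp [hv, hu, hx, survival]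
        rw [← hvx, sq]
        exact mul_le_mul_of_nonneg_right (hvu x) (hv0 x)
    have hu2 : 0 ≤ ∑ x, μ x * u x ^ 2 :=
      Finset.sum_nonneg fun x _ => mul_nonneg (hμ x) (sq_nonneg _)
    have hp := hpoinc u fun x hx => by simp [hu, hx]
    rw [sum_sq_sub_eq P hP1 hrev] at hp
    have hp' : (1 / (2 * D)) * ∑ x, μ x * u x ^ 2
        ≤ ∑ x, μ x * u x ^ 2 - ∑ x, μ x * (u x * ∑ y, P x y * u y) := by
      rw [one_div, inv_mul_le_iff₀ (by positivity)]
      linarith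
    calc ∑ x, μ x * v x ^ 2 ≤ (1 - 1 / (2 * D)) * ∑ x, μ x * u x ^ 2 := by linarith
      _ ≤ Real.exp (-(1 / (2 * D))) * ∑ x, μ x * u x ^ 2 :=
          mul_le_mul_of_nonneg_right (Real.one_sub_le_exp_neg _) hu2
      _ ≤ Real.exp (-(1 / (2 * D))) * (Real.exp (-(n / (2 * D))) * ∑ x, μ x) :=
          mul_le_mul_of_nonneg_left ih (Real.exp_nonneg _)
      _ = _ := by
          rw [← mul_assoc, ← Real.exp_add]
          congr 2
          push_cast
          ring

end ReversibleChain

/-! ### Detailed balance and the Poincaré inequality -/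

section Boltzmann

variable {K L q : ℕ}

/-- The right side is symmetric, which gives reversibility; it also bounds the conductance of a flip
from below by the height of its higher endpoint. -/
theorem boltzmann_mul_jump (h : ℝ) (β : ℝ≥0) (σ τ : Config K L q) :
    Real.exp (-β * energy h σ) * jump h β σ τ
      = connectivity σ τ * Real.exp (-β * max (energy h σ) (energy h τ)) := by
  have : max (energy h σ) (energy h τ) = energy h σ + max 0 (energy h τ - energy h σ) := by
    rw [← max_add_add_left]; simp
  rw [jump, this, mul_left_comm, ← Real.exp_add]
  congr 2
  ring

theorem connectivity_comm (σ τ : Config K L q) : connectivity σ τ = connectivity τ σ := by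
  simp only [connectivity, hammingDist_comm]

theorem boltzmann_reversible (h : ℝ) (β : ℝ≥0) (σ τ : Config K L q) :
    Real.exp (-β * energy h σ) * transition h β σ τ
      = Real.exp (-β * energy h τ) * transition h β τ σ := by
  by_cases hστ : σ = τ
  · rw [hστ]
  · rw [transition, transition, if_neg hστ, if_neg (Ne.symm hστ), boltzmann_mul_jump,
      boltzmann_mul_jump, connectivity_comm, max_comm]

/-- The Poincaré inequality with Dirichlet conditions on `{𝟏, …, 𝐪}`: the relaxation time is at
most of order `exp (2 β)`. -/
theorem exists_poincare (hK : 3 ≤ K) (hL : 3 ≤ L) (hq : 0 < q) (h : ℝ) :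
    ∃ C : ℝ, 0 < C ∧ ∀ (β : ℝ≥0) (f : Config K L q → ℝ), (∀ σ ∈ monochromatic K L q, f σ = 0) →
      ∑ σ, Real.exp (-β * energy h σ) * f σ ^ 2 ≤ C * Real.exp (2 * β) *
        ∑ σ, ∑ τ, Real.exp (-β * energy h σ) * transition h β σ τ * (f σ - f τ) ^ 2 := by
  have path : ∀ σ : Config K L q, ∃ n : ℕ, ∀ (f : Config K L q → ℝ) (D : ℝ),
      (∀ σ ∈ monochromatic K L q, f σ = 0) →
      (∀ y z, LowFlip (energy h) (energy h σ + 2) y z → |f y - f z| ≤ D) → |f σ| ≤ n * D := by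
    intro σ
    obtain ⟨τ, hτ, hp⟩ := exists_path_monochromatic hK hL h σ
    obtain ⟨n, hn⟩ := exists_path_length hp
    refine ⟨n, fun f D hf hD => ?_⟩
    simpa [hf τ hτ] using hn f D hD
  choose n hn using path
  set N : ℝ := (q : ℝ) * Fintype.card (Vertex K L) with hN
  have hNpos : 0 < N := by
    have : 0 < Fintype.card (Vertex K L) := by
      rw [Fintype.card_prod, Fintype.card_fin, Fintype.card_fin]
      exact Nat.mul_pos (by omega) (by omega)
    positivity
  refine ⟨N * ∑ σ, (n σ : ℝ) ^ 2 + 1, by positivity, fun β f hf => ?_⟩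
  set I := ∑ σ, ∑ τ, Real.exp (-β * energy h σ) * transition h β σ τ * (f σ - f τ) ^ 2 with hI
  have hterm : ∀ σ τ, 0 ≤ Real.exp (-β * energy h σ) * transition h β σ τ * (f σ - f τ) ^ 2 :=
    fun σ τ => mul_nonneg (mul_nonneg (Real.exp_nonneg _) (transition_nonneg h β σ τ))
      (sq_nonneg _)
  have hI0 : 0 ≤ I := Finset.sum_nonneg fun σ _ => Finset.sum_nonneg fun τ _ => hterm σ τ
  -- A single flip is one term of the Dirichlet form `I`, with conductance at least `exp (-β M) /
  -- N`.
  have edge : ∀ M y z, LowFlip (energy h) M y z →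
      |f y - f z| ≤ Real.sqrt (N * Real.exp (β * M) * I) := by
    rintro M y z ⟨hd, hy, hz⟩
    have hyz : y ≠ z := by
      rintro rfl
      simp at hd
    refine Real.abs_le_sqrt ?_
    have h1 : Real.exp (-β * energy h y) * transition h β y z * (f y - f z) ^ 2 ≤ I :=
      (Finset.single_le_sum (fun τ _ => hterm y τ) (Finset.mem_univ z)).trans
        (Finset.single_le_sum (f := fun σ => ∑ τ, Real.exp (-β * energy h σ) *
          transition h β σ τ * (f σ - f τ) ^ 2)
          (fun σ _ => Finset.sum_nonneg fun τ _ => hterm σ τ) (Finset.mem_univ y))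
    rw [transition, if_neg hyz, boltzmann_mul_jump, connectivity, if_pos hd, ← hN] at h1
    have h2 : Real.exp (-(β * M)) ≤ Real.exp (-β * max (energy h y) (energy h z)) := by
      refine Real.exp_le_exp.mpr ?_
      rw [neg_mul]
      exact neg_le_neg (mul_le_mul_of_nonneg_left (max_le hy hz) β.2)
    have h3 : 1 / N * Real.exp (-(β * M)) * (f y - f z) ^ 2 ≤ I :=
      (mul_le_mul_of_nonneg_right (mul_le_mul_of_nonneg_left h2 (by positivity))
        (sq_nonneg _)).trans h1
    calc (f y - f z) ^ 2
        = N * Real.exp (β * M) * (1 / N * Real.exp (-(β * M)) * (f y - f z) ^ 2) := by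
          rw [Real.exp_neg]
          field_simp
      _ ≤ _ := mul_le_mul_of_nonneg_left h3 (by positivity)
  have single : ∀ σ, Real.exp (-β * energy h σ) * f σ ^ 2
      ≤ (n σ : ℝ) ^ 2 * (N * Real.exp (2 * β) * I) := by
    intro σ
    have h1 := hn σ f _ hf (edge (energy h σ + 2))
    have h2 : f σ ^ 2 ≤ (n σ : ℝ) ^ 2 * (N * Real.exp (β * (energy h σ + 2)) * I) := by
      rw [← sq_abs (f σ)]
      refine (pow_le_pow_left₀ (abs_nonneg _) h1 2).trans ?_
      rw [mul_pow, Real.sq_sqrt (by positivity)]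
    refine (mul_le_mul_of_nonneg_left h2 (Real.exp_nonneg _)).trans (le_of_eq ?_)
    -- The weight of `σ` cancels its own energy in the path's ceiling, leaving only the climb `2`.
    have : Real.exp (2 * β) = Real.exp (-β * energy h σ) * Real.exp (β * (energy h σ + 2)) := by
      rw [← Real.exp_add]
      congr 1
      ring
    rw [this]
    ring
  calc _ ≤ ∑ σ, (n σ : ℝ) ^ 2 * (N * Real.exp (2 * β) * I) := Finset.sum_le_sum fun σ _ => single σ
    _ = N * (∑ σ, (n σ : ℝ) ^ 2) * Real.exp (2 * β) * I := by rw [← Finset.sum_mul]; ring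
    _ ≤ _ := by
      have : 0 ≤ Real.exp (2 * β) * I := by positivity
      nlinarith

end Boltzmann

/-! ### From the trajectory law to the transition matrix -/

section Law

variable {K L q : ℕ}

theorem lintegral_stepKernel (h : ℝ) (β : ℝ≥0) (σ : Config K L q) (φ : Config K L q → ℝ≥0∞) :
    ∫⁻ τ, φ τ ∂(stepKernel K L q h β σ)
      = ∑ τ, ENNReal.ofReal (transition h β σ τ) * φ τ := by
  rw [lintegral_fintype]
  refine Finset.sum_congr rfl fun τ _ => ?_
  have : stepKernel K L q h β σ {τ} = ENNReal.ofReal (transition h β σ τ) := by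
    change (stepPMF h β σ).toMeasure {τ} = _
    rw [PMF.toMeasure_apply_singleton _ _ (measurableSet_singleton τ)]
    rfl
  rw [this, mul_comm]

theorem chainLaw_map_zero (h : ℝ) (β : ℝ≥0) (σ : Config K L q) :
    (chainLaw h β σ).map (fun ω => ω 0) = Measure.dirac σ := by
  have h1 : (chainLaw h β σ).map (Preorder.frestrictLe 0)
      = (Measure.dirac σ).map
        (MeasurableEquiv.piUnique (fun i : Finset.Iic 0 => Config K L q)).symm := by
    rw [chainLaw, Kernel.trajMeasure, Measure.map_comp _ _ (by fun_prop),
      Kernel.traj_map_frestrictLe, Kernel.partialTraj_self, Measure.id_comp]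
  have h2 : (fun ω : ℕ → Config K L q => ω 0)
      = (fun y : Finset.Iic 0 → Config K L q => y ⟨0, Finset.mem_Iic.mpr le_rfl⟩)
        ∘ (Preorder.frestrictLe (π := fun _ => Config K L q) 0) := rfl
  rw [h2, ← Measure.map_map (by fun_prop) (by fun_prop), h1,
    Measure.map_map (by fun_prop) (by fun_prop), Measure.map_dirac' (by fun_prop)]
  rfl

/-- The Markov property at time `n`, tested against functions of the past and the next state. -/
theorem lintegral_chainLaw_succ (h : ℝ) (β : ℝ≥0) (σ : Config K L q) (n : ℕ)
    (G : (Finset.Iic n → Config K L q) × Config K L q → ℝ≥0∞) :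
    ∫⁻ ω, G (Preorder.frestrictLe (π := fun _ => Config K L q) n ω, ω (n + 1)) ∂(chainLaw h β σ)
      = ∫⁻ ω, ∑ τ, ENNReal.ofReal (transition h β (ω n) τ) *
          G (Preorder.frestrictLe (π := fun _ => Config K L q) n ω, τ) ∂(chainLaw h β σ) := by
  have hG : Measurable G := .of_discrete
  rw [← lintegral_map (f := G) (g := fun ω : ℕ → Config K L q =>
    (Preorder.frestrictLe (π := fun _ => Config K L q) n ω, ω (n + 1))) hG (by fun_prop)]
  have key := Kernel.map_frestrictLe_trajMeasure_compProd_eq_map_trajMeasure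
    (X := fun _ => Config K L q) (μ₀ := Measure.dirac σ) (κ := historyKernel K L q h β) (a := n)
  have : IsProbabilityMeasure (chainLaw h β σ) := by unfold chainLaw; infer_instance
  change ((chainLaw h β σ).map _) ⊗ₘ _ = (chainLaw h β σ).map _ at key
  rw [← key, Measure.lintegral_compProd hG, lintegral_map .of_discrete (by fun_prop)]
  refine lintegral_congr fun ω => ?_
  rw [historyKernel, Kernel.comap_apply, lintegral_stepKernel]
  rfl

/-- Conditioning on the past trades one elapsed step for one step of `survival`, so the integral
depends only on `n + m`. The general `m` is needed for the induction; `m = 0` gives the avoidance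
probability. -/
theorem lintegral_avoid_survival (h : ℝ) (β : ℝ≥0) (σ : Config K L q)
    (A : Set (Config K L q)) (n m : ℕ) :
    ∫⁻ ω, {ω : ℕ → Config K L q | ∀ t, 0 < t → t ≤ n → ω t ∉ A}.indicator
        (fun ω => ENNReal.ofReal (survival (transition h β) A m (ω n))) ω ∂(chainLaw h β σ)
      = ENNReal.ofReal (survival (transition h β) A (n + m) σ) := by
  induction n generalizing m with
  | zero =>
    have : {ω : ℕ → Config K L q | ∀ t, 0 < t → t ≤ 0 → ω t ∉ A} = Set.univ := by
      ext ω
      simp only [Set.mem_ofPred_eq, Set.mem_univ, iff_true]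
      omega
    rw [this, Set.indicator_univ, zero_add,
      ← lintegral_map (f := fun τ => ENNReal.ofReal (survival (transition h β) A m τ))
        (g := fun ω : ℕ → Config K L q => ω 0) .of_discrete (by fun_prop),
      chainLaw_map_zero, lintegral_dirac]
  | succ n ih =>
    rw [add_right_comm, add_assoc, ← ih (m + 1)]
    set B : Set (Finset.Iic n → Config K L q) := {y | ∀ t, 0 < t.1 → y t ∉ A} with hB
    set φ : Config K L q → ℝ≥0∞ :=
      fun τ => ENNReal.ofReal (Aᶜ.indicator (survival (transition h β) A m) τ) with hφ
    have hmem : ∀ ω : ℕ → Config K L q,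
        Preorder.frestrictLe (π := fun _ => Config K L q) n ω ∈ B ↔
          ∀ t, 0 < t → t ≤ n → ω t ∉ A := by
      intro ω
      constructor
      · exact fun hω t h0 hn => hω ⟨t, Finset.mem_Iic.mpr hn⟩ h0
      · exact fun hω t h0 => hω t.1 h0 (Finset.mem_Iic.mp t.2)
    have hstep := lintegral_chainLaw_succ h β σ n (fun p => B.indicator (fun _ => φ p.2) p.1)
    convert hstep using 2
    · ext ω
      have hsucc : (∀ t, 0 < t → t ≤ n + 1 → ω t ∉ A) ↔
          (∀ t, 0 < t → t ≤ n → ω t ∉ A) ∧ ω (n + 1) ∉ A := by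
        constructor
        · exact fun hω => ⟨fun t h0 hn => hω t h0 (by omega), hω _ (by omega) le_rfl⟩
        · rintro ⟨h1, h2⟩ t h0 hn
          rcases Nat.le_succ_iff.mp hn with hn | rfl
          · exact h1 t h0 hn
          · exact h2
      by_cases h1 : ∀ t, 0 < t → t ≤ n → ω t ∉ A
      · rw [Set.indicator_of_mem ((hmem ω).mpr h1)]
        by_cases h2 : ω (n + 1) ∈ A
        · rw [Set.indicator_of_notMem (by simp only [Set.mem_ofPred_eq, hsucc]; tauto)]
          simp [hφ, h2]
        · rw [Set.indicator_of_mem (by simp only [Set.mem_ofPred_eq, hsucc]; tauto)]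
          simp [hφ, h2]
      · rw [Set.indicator_of_notMem (fun hc => h1 ((hmem ω).mp hc)),
          Set.indicator_of_notMem (by simp only [Set.mem_ofPred_eq, hsucc]; tauto)]
    · ext ω
      by_cases h1 : ∀ t, 0 < t → t ≤ n → ω t ∉ A
      · rw [Set.indicator_of_mem (by exact h1)]
        simp only [Set.indicator_of_mem ((hmem ω).mpr h1), hφ, survival]
        rw [ENNReal.ofReal_sum_of_nonneg]
        · exact Finset.sum_congr rfl fun τ _ =>
            ENNReal.ofReal_mul (transition_nonneg h β _ _)
        · exact fun τ _ => mul_nonneg (transition_nonneg h β _ _)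
            (Set.indicator_nonneg (fun τ _ => survival_nonneg _ A (transition_nonneg h β) m τ) τ)
      · rw [Set.indicator_of_notMem (by exact h1)]
        simp [Set.indicator_of_notMem (fun hc => h1 ((hmem ω).mp hc))]

theorem hittingTail_le_survival (h : ℝ) (β : ℝ≥0) (σ : Config K L q) (A : Set (Config K L q))
    {T : ℝ} {n : ℕ} (hn : n ≤ T) :
    hittingTail h β σ A T ≤ ENNReal.ofReal (survival (transition h β) A n σ) := by
  have hmeas : MeasurableSet {ω : ℕ → Config K L q | ∀ t, 0 < t → t ≤ n → ω t ∉ A} := by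
    simp only [Set.ofPred_forall]
    refine .iInter fun t => .iInter fun _ => .iInter fun _ => ?_
    exact (MeasurableSet.of_discrete (s := Aᶜ)).preimage
      (measurable_pi_apply (X := fun _ => Config K L q) t)
  have hsub : {ω : ℕ → Config K L q | ENNReal.ofReal T < (hittingTime A ω : ℝ≥0∞)}
      ⊆ {ω | ∀ t, 0 < t → t ≤ n → ω t ∉ A} := by
    intro ω hω t h0 ht hA
    refine absurd (show ENNReal.ofReal T < (hittingTime A ω : ℝ≥0∞) from hω) (not_lt.mpr ?_)
    have h1 : hittingTime A ω ≤ t := iInf₂_le t ⟨h0, hA⟩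
    calc (hittingTime A ω : ℝ≥0∞) ≤ ((t : ℕ∞) : ℝ≥0∞) := by exact_mod_cast h1
      _ = ENNReal.ofReal t := by simp
      _ ≤ ENNReal.ofReal T :=
          ENNReal.ofReal_le_ofReal ((Nat.cast_le.mpr ht).trans hn)
  refine (measure_mono hsub).trans (le_of_eq ?_)
  have := lintegral_avoid_survival h β σ A n 0
  simp only [survival, ENNReal.ofReal_one, add_zero] at this
  rw [← this, ← lintegral_indicator_one hmeas]
  rfl

end Law

end Potts

/-! ### Asymptotics in `β` and conclusion -/

namespace Potts

theorem superExpSmall_exp_neg_exp {k : ℝ} (hk : 0 < k) :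
    SuperExpSmall fun β => ENNReal.ofReal (Real.exp (-Real.exp (k * β))) := by
  have hreal : Tendsto (fun β : ℝ≥0 => 1 / (β : ℝ) * -Real.exp (k * β)) atTop atBot := by
    have h1 : Tendsto (fun x : ℝ => Real.exp x / x) atTop atTop := by
      simpa using Real.tendsto_exp_div_pow_atTop 1
    have h2 : Tendsto (fun β : ℝ≥0 => k * (β : ℝ)) atTop atTop :=
      (NNReal.tendsto_coe_atTop.mpr tendsto_id).const_mul_atTop hk
    have h3 := tendsto_neg_atTop_atBot.comp ((h1.comp h2).const_mul_atTop hk)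
    refine h3.congr fun β => ?_
    simp only [Function.comp_apply]
    -- At `β = 0` both sides vanish, since division by zero gives zero.
    by_cases hβ : (β : ℝ) = 0
    · simp [hβ]
    · field_simp
  unfold SuperExpSmall
  refine (EReal.tendsto_coe_nhds_bot_iff.mpr hreal).congr fun β => ?_
  rw [ENNReal.log_ofReal_of_pos (Real.exp_pos _), Real.log_exp, EReal.coe_mul]

theorem SuperExpSmall.mono {f g : ℝ≥0 → ℝ≥0∞} (hg : SuperExpSmall g)
    (hfg : ∀ᶠ β in atTop, f β ≤ g β) : SuperExpSmall f := by
  refine tendsto_of_tendsto_of_tendsto_of_le_of_le' tendsto_const_nhds hg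
    (Eventually.of_forall fun _ => bot_le) ?_
  filter_upwards [hfg] with β hβ
  refine mul_le_mul_of_nonneg_left (ENNReal.log_le_log hβ) ?_
  exact_mod_cast one_div_nonneg.mpr β.2

/-- In `y = exp (εβ/2)` the right side is quadratic and the left at most linear. The terms pay for
the number of configurations, the spread of Boltzmann weights, the rounding of time, and the squared
target bound. -/
theorem eventually_exponent_le {B C N ε : ℝ} (hB : 0 ≤ B) (hC : 0 < C) (hN : 1 ≤ N) (hε : 0 < ε) :
    ∀ᶠ β : ℝ≥0 in atTop, Real.log N + 2 * B * β + 1 / C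
      + 2 * Real.exp (ε / 2 * β) ≤ Real.exp (ε * β) / (2 * C) := by
  have hlim : Tendsto (fun β : ℝ≥0 => Real.exp (ε / 2 * β)) atTop atTop :=
    Real.tendsto_exp_atTop.comp
      ((NNReal.tendsto_coe_atTop.mpr tendsto_id).const_mul_atTop (by positivity))
  filter_upwards [hlim.eventually_ge_atTop (2 * C * (Real.log N + 1 / C + 2 + 4 * B / ε))]
    with β hβ
  set y := Real.exp (ε / 2 * β) with hy
  have hlog : 0 ≤ Real.log N := Real.log_nonneg hN
  have hβ0 : (0 : ℝ) ≤ β := β.2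
  have hy1 : 1 ≤ y := Real.one_le_exp (by positivity)
  have hβy : 2 * B * β ≤ 4 * B / ε * y := by
    have h1 : ε / 2 * β ≤ y := by linarith [Real.add_one_le_exp (ε / 2 * (β : ℝ))]
    calc 2 * B * β = 4 * B / ε * (ε / 2 * β) := by field_simp; ring
      _ ≤ _ := mul_le_mul_of_nonneg_left h1 (by positivity)
  have hsq : Real.exp (ε * β) = y * y := by
    rw [hy, ← Real.exp_add]
    congr 1
    ring
  have hc : 0 ≤ Real.log N + 1 / C := by positivity
  calc Real.log N + 2 * B * β + 1 / C + 2 * y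
      ≤ (Real.log N + 1 / C + 2 + 4 * B / ε) * y := by nlinarith
    _ ≤ y / (2 * C) * y := by
        refine mul_le_mul_of_nonneg_right ?_ (by positivity)
        rw [le_div_iff₀ (by positivity)]
        linarith
    _ = _ := by rw [hsq]; ring

theorem eventually_survival_le {K L q : ℕ} (hK : 3 ≤ K) (hL : 3 ≤ L) (hq : 0 < q) (h : ℝ)
    {ε : ℝ} (hε : 0 < ε) :
    ∀ᶠ β : ℝ≥0 in atTop, ∀ σ : Config K L q,
      survival (transition h β) (monochromatic K L q) ⌊Real.exp (β * (2 + ε))⌋₊ σ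
        ≤ Real.exp (-Real.exp (ε / 2 * β)) := by
  obtain ⟨C, hC, hpoinc⟩ := exists_poincare hK hL hq h
  obtain ⟨B, hB⟩ : ∃ B, ∀ σ : Config K L q, |energy h σ| ≤ B :=
    ⟨∑ σ : Config K L q, |energy h σ|, fun σ =>
      Finset.single_le_sum (f := fun σ : Config K L q => |energy h σ|)
        (fun _ _ => abs_nonneg _) (Finset.mem_univ σ)⟩
  have : NeZero K := ⟨by omega⟩
  have : NeZero L := ⟨by omega⟩
  have : Nonempty (Config K L q) := ⟨fun _ => ⟨1, Finset.mem_Icc.mpr ⟨le_rfl, hq⟩⟩⟩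
  set N : ℝ := (Fintype.card (Config K L q) : ℝ) with hN
  have hN1 : 1 ≤ N := by
    rw [hN]
    exact_mod_cast Fintype.card_pos (α := Config K L q)
  have hB0 : 0 ≤ B := (abs_nonneg _).trans (hB (Classical.arbitrary _))
  filter_upwards [eventually_exponent_le hB0 hC hN1 hε] with β hβ σ
  have hβ0 : (0 : ℝ) ≤ β := β.2
  set T := Real.exp (β * (2 + ε)) with hT
  have hT1 : 1 ≤ T := Real.one_le_exp (by positivity)
  -- One step is set aside: the mean-square bound controls survival only off the target, while `σ`
  -- may lie in it. Averaging over the first step covers every `σ`.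
  obtain ⟨n, hn⟩ := Nat.exists_eq_add_of_le' ((Nat.one_le_floor_iff T).mpr hT1)
  have hnT : T - 2 ≤ n := by
    have := Nat.lt_floor_add_one T
    rw [hn] at this
    push_cast at this
    linarith
  rw [hn]
  set D := C * Real.exp (2 * β) with hD
  have hDC : C ≤ D := le_mul_of_one_le_right hC.le (Real.one_le_exp (by positivity))
  have hDpos : 0 < D := hC.trans_le hDC
  have hexp : Real.exp (ε * β) / (2 * C) - 1 / C ≤ n / (2 * D) := by
    have h1 : Real.exp (ε * β) / (2 * C) = T / (2 * D) := by
      have : T = Real.exp (2 * β) * Real.exp (ε * β) := by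
        rw [hT, ← Real.exp_add]
        congr 1
        ring
      rw [this, hD]
      field_simp
    have h2 : 1 / D ≤ 1 / C := one_div_le_one_div_of_le hC hDC
    have h3 : (T - 2) / (2 * D) ≤ n / (2 * D) := by gcongr
    have h4 : (T - 2) / (2 * D) = T / (2 * D) - 1 / D := by field_simp
    linarith
  have hsum := sum_sq_survival_le (transition h β) (monochromatic K L q)
    (fun τ => Real.exp_nonneg (-β * energy h τ)) (transition_nonneg h β) (sum_transition h β)
    (boltzmann_reversible h β) hDpos (hpoinc β) n
  have hZ : ∑ τ : Config K L q, Real.exp (-β * energy h τ) ≤ N * Real.exp (β * B) := by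
    calc _ ≤ ∑ _τ : Config K L q, Real.exp (β * B) := by
          refine Finset.sum_le_sum fun τ _ => Real.exp_le_exp.mpr ?_
          have := neg_le_of_abs_le (hB τ)
          nlinarith
      _ = _ := by simp [hN]
  have hpoint : ∀ τ, (monochromatic K L q)ᶜ.indicator
      (survival (transition h β) (monochromatic K L q) n) τ
        ≤ Real.exp (-Real.exp (ε / 2 * β)) := by
    intro τ
    set u := (monochromatic K L q)ᶜ.indicator
      (survival (transition h β) (monochromatic K L q) n) with hu
    have h1 : Real.exp (-β * energy h τ) * u τ ^ 2
        ≤ Real.exp (-(n / (2 * D))) * (N * Real.exp (β * B)) :=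
      (Finset.single_le_sum (f := fun τ => Real.exp (-β * energy h τ) * u τ ^ 2)
        (fun τ _ => mul_nonneg (Real.exp_nonneg _) (sq_nonneg _)) (Finset.mem_univ τ)).trans
        (hsum.trans (mul_le_mul_of_nonneg_left hZ (Real.exp_nonneg _)))
    have h2 : Real.exp (-(β * B)) ≤ Real.exp (-β * energy h τ) := by
      refine Real.exp_le_exp.mpr ?_
      have := le_of_abs_le (hB τ)
      nlinarith
    have h3 : u τ ^ 2 ≤ Real.exp (-Real.exp (ε / 2 * β)) ^ 2 := by
      calc u τ ^ 2 = Real.exp (β * B) * (Real.exp (-(β * B)) * u τ ^ 2) := by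
            rw [← mul_assoc, ← Real.exp_add, add_neg_cancel, Real.exp_zero, one_mul]
        _ ≤ Real.exp (β * B) * (Real.exp (-(n / (2 * D))) * (N * Real.exp (β * B))) :=
            mul_le_mul_of_nonneg_left
              ((mul_le_mul_of_nonneg_right h2 (sq_nonneg _)).trans h1) (Real.exp_nonneg _)
        _ = Real.exp (Real.log N + 2 * B * β - n / (2 * D)) := by
            rw [show Real.log N + 2 * B * β - n / (2 * D)
              = β * B + (-(n / (2 * D)) + (Real.log N + β * B)) by ring, Real.exp_add,
              Real.exp_add, Real.exp_add, Real.exp_log (by linarith)]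
        _ ≤ Real.exp (-Real.exp (ε / 2 * β)) ^ 2 := by
            rw [← Real.exp_nat_mul]
            refine Real.exp_le_exp.mpr ?_
            push_cast
            linarith
    exact le_of_abs_le (abs_le_of_sq_le_sq h3 (Real.exp_nonneg _))
  calc survival (transition h β) (monochromatic K L q) (n + 1) σ
      ≤ ∑ τ, transition h β σ τ * Real.exp (-Real.exp (ε / 2 * β)) :=
        Finset.sum_le_sum fun τ _ =>
          mul_le_mul_of_nonneg_left (hpoint τ) (transition_nonneg h β σ τ)
    _ = _ := by rw [← Finset.sum_mul, sum_transition, one_mul]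

end Potts

theorem theorem4p5 (K L q : ℕ) (h : ℝ) (hq : 2 < q) (h_pos : 0 < h) (h_lt : h < 1)
    (h_int : ¬ ∃ n : ℤ, 2 / h = n)
    (hK : 3 * Potts.criticalLength h ≤ K) (hL : 3 * Potts.criticalLength h ≤ L)
    (σ : Potts.Config K L q) (ε : ℝ) (hε : 0 < ε) :
    (∃ k : ℝ, 0 < k ∧
      (∀ᶠ β : ℝ≥0 in atTop,
        Potts.hittingTail h β σ (Potts.monochromatic K L q) (Real.exp (β * (2 + ε)))
          ≤ ENNReal.ofReal (Real.exp (-Real.exp (k * β)))) ∧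
      Potts.SuperExpSmall (fun β => ENNReal.ofReal (Real.exp (-Real.exp (k * β))))) ∧
    Potts.SuperExpSmall (fun β =>
      Potts.hittingTail h β σ (Potts.monochromatic K L q) (Real.exp (β * (2 + ε)))) := by
  -- This yields `3 ≤ K` and `3 ≤ L`, all that the argument needs of the critical length.
  have hcrit : 1 ≤ Potts.criticalLength h := Nat.ceil_pos.mpr (by positivity)
  have hbound : ∀ᶠ β : ℝ≥0 in atTop,
      Potts.hittingTail h β σ (Potts.monochromatic K L q) (Real.exp (β * (2 + ε)))
        ≤ ENNReal.ofReal (Real.exp (-Real.exp (ε / 2 * β))) := by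
    filter_upwards [Potts.eventually_survival_le (K := K) (L := L) (by omega) (by omega)
      (show 0 < q by omega) h hε] with β hβ
    exact (Potts.hittingTail_le_survival h β σ _ (Nat.floor_le (Real.exp_nonneg _))).trans
      (ENNReal.ofReal_le_ofReal (hβ σ))
  have hsmall := Potts.superExpSmall_exp_neg_exp (half_pos hε)
  exact ⟨⟨ε / 2, half_pos hε, hbound, hsmall⟩, hsmall.mono hbound⟩
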